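/- Theorem 4.1. Let $T>0$, $A\in\mathbb{R}^{n\times n}$, $B\in\mathbb{R}^{n\times 1}$ and $\xi\in\mathbb{R}^n$. A control is a real-valued $u\in L^\infty[0,T]$ (functions that agree almost everywhere are identified). It is admissible for $\xi$ if $\|u\|_\infty\le 1$ and the solution of $\dot x(t)=Ax(t)+Bu(t)$, $x(0)=\xi$, satisfies $x(T)=0$; let $U(\xi)$ be the set of admissible controls. Let $\|u\|_1=\int_0^T|u(t)|\,dt$ and $\|u\|_0=m(\operatorname{supp}u)$, where $m$ is Lebesgue measure and $\operatorname{supp}u$ is the closed support of $u$, i.e. the set of all $t\in[0,T]$ such that $\{s\in N\cap[0,T]: u(s)\neq 0\}$ has positive measure for every neighbourhood $N$ of $t$ (equivalently, the smallest of the sets $\overline{\{s\in[0,T]:v(s)\ne0\}}$ over all representatives $v$ of $u$). Let $U_0^*(\xi)$ (the sparse optimal controls) and $U_1^*(\xi)$ (the $L^1$-optimal controls) be the sets of minimizers over $U(\xi)$ of $\|u\|_0$ and of $\|u\|_1$, respectively. The $L^1$-optimal control problem for $\xi$ is called normal if $m(\{t\in[0,T]:|B^{\mathrm T}p(t)|=1\})=0$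 for every $u\in U_1^*(\xi)$ and every costate $p$ that satisfies Pontryagin's minimum principle together with $u$, that is, every $p:[0,T]\to\mathbb{R}^n$ with $\dot p(t)=-A^{\mathrm T}p(t)$ on $[0,T]$ such that, for almost every $t\in[0,T]$ and all $w\in[-1,1]$, $$|u(t)|+p(t)^{\mathrm T}\bigl(Ax(t)+Bu(t)\bigr)\le |w|+p(t)^{\mathrm T}\bigl(Ax(t)+Bw\bigr),$$ where $x$ is the trajectory of $u$ starting at $\xi$. Assume that the $L^1$-optimal control problem for $\xi$ is normal and that $U_1^*(\xi)\neq\emptyset$. Then $U_0^*(\xi)=U_1^*(\xi)$, and $\|u_0\|_0=\|u_1\|_1$ for all $u_0\in U_0^*(\xi)$ and $u_1\in U_1^*(\xi)$. -/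

import Mathlib

open MeasureTheory Set
open scoped ENNReal Matrix Topology

noncomputable section

namespace SparseControl

/-- Lebesgue measure on the horizon `[0, T]`. -/
abbrev horizon (T : ℝ) : Measure ℝ := volume.restrict (Icc 0 T)

/-- Control signals on `[0, T]`: elements of `L^∞[0, T]`, that is, essentially bounded measurable
functions up to equality almost everywhere. -/
abbrev Signal (T : ℝ) : Type := Lp ℝ ∞ (horizon T)

variable {n : ℕ} {T : ℝ}

/-- The `L¹` norm of a signal. -/
def l1Norm (u : Signal T) : ℝ≥0∞ := eLpNorm u 1 (horizon T)

/-- The (closed) support of a signal, as an almost-everywhere class: the points `t` of `[0, T]`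
all of whose neighbourhoods meet `{s ∈ [0, T] | u s ≠ 0}` in a set of positive measure. It is the
smallest of the closed sets `closure {s ∈ [0, T] | v s ≠ 0}`, where `v` runs through the
representatives of `u`. -/
def signalSupport (u : Signal T) : Set ℝ :=
  {t | t ∈ Icc 0 T ∧ ∀ N ∈ 𝓝 t, 0 < volume {s | s ∈ N ∧ s ∈ Icc 0 T ∧ u s ≠ 0}}

/-- The `L⁰` norm of a signal: the Lebesgue measure of its closed support. -/
def l0Norm (u : Signal T) : ℝ≥0∞ := volume (signalSupport u)

/-- `x` is the trajectory on `[0, T]` of `dx/dt = A x + B u`, `x(0) = ξ` (in the sense of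
Carathéodory, that is, in integrated form). -/
structure IsTrajectory (A : Matrix (Fin n) (Fin n) ℝ) (B : Fin n → ℝ) (ξ : Fin n → ℝ)
    (u : Signal T) (x : ℝ → Fin n → ℝ) : Prop where
  continuousOn : ContinuousOn x (Icc 0 T)
  eq_integral : ∀ t ∈ Icc 0 T, x t = ξ + ∫ s in (0 : ℝ)..t, (A *ᵥ x s + u s • B)

/-- The admissible controls for the initial state `ξ`: `‖u‖_∞ ≤ 1` and `u` steers `ξ` to the
origin at time `T`. -/
def admissible (A : Matrix (Fin n) (Fin n) ℝ) (B : Fin n → ℝ) (T : ℝ) (ξ : Fin n → ℝ) :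
    Set (Signal T) :=
  {u | ‖u‖ ≤ 1 ∧ ∃ x : ℝ → Fin n → ℝ, IsTrajectory A B ξ u x ∧ x T = 0}

/-- The optimal solutions of the sparse optimal control problem `P₀`. -/
def sparseOptimal (A : Matrix (Fin n) (Fin n) ℝ) (B : Fin n → ℝ) (T : ℝ) (ξ : Fin n → ℝ) :
    Set (Signal T) :=
  {u | u ∈ admissible A B T ξ ∧ ∀ v ∈ admissible A B T ξ, l0Norm u ≤ l0Norm v}

/-- The optimal solutions of the `L¹`-optimal control problem `P₁`. -/
def l1Optimal (A : Matrix (Fin n) (Fin n) ℝ) (B : Fin n → ℝ) (T : ℝ) (ξ : Fin n → ℝ) :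
    Set (Signal T) :=
  {u | u ∈ admissible A B T ξ ∧ ∀ v ∈ admissible A B T ξ, l1Norm u ≤ l1Norm v}

/-- The Hamiltonian `H(x, p, u) = |u| + pᵀ (A x + B u)` of the problem `P₁`. -/
def hamiltonian (A : Matrix (Fin n) (Fin n) ℝ) (B : Fin n → ℝ) (x p : Fin n → ℝ) (w : ℝ) : ℝ :=
  |w| + p ⬝ᵥ (A *ᵥ x + w • B)

/-- The conditions of Pontryagin's minimum principle for the problem `P₁`: `x` is the trajectory
of `u` from `ξ` to `0`, the costate `p` solves the adjoint equation on `[0, T]`, and at almost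
every time the control value minimizes the Hamiltonian over all values in `[-1, 1]`. -/
structure MinimumPrinciple (A : Matrix (Fin n) (Fin n) ℝ) (B : Fin n → ℝ) (ξ : Fin n → ℝ)
    (u : Signal T) (x p : ℝ → Fin n → ℝ) : Prop where
  trajectory : IsTrajectory A B ξ u x
  final : x T = 0
  adjoint : ∀ t ∈ Icc 0 T, HasDerivWithinAt p (-(Aᵀ *ᵥ p t)) (Icc 0 T) t
  minimum : ∀ᵐ t ∂(horizon T), ∀ w : ℝ, |w| ≤ 1 →
    hamiltonian A B (x t) (p t) (u t) ≤ hamiltonian A B (x t) (p t) w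

/-- Normality of `P₁` for the initial state `ξ`: for every `L¹`-optimal control and every costate
that the minimum principle allows for it, `{t ∈ [0, T] | |Bᵀ p(t)| = 1}` has measure zero. -/
def IsNormal (A : Matrix (Fin n) (Fin n) ℝ) (B : Fin n → ℝ) (T : ℝ) (ξ : Fin n → ℝ) : Prop :=
  ∀ u ∈ l1Optimal A B T ξ, ∀ x p : ℝ → Fin n → ℝ, MinimumPrinciple A B ξ u x p →
    volume {t | t ∈ Icc 0 T ∧ |B ⬝ᵥ p t| = 1} = 0

end SparseControl

end

/-!
By variation of constants, `u` steers `ξ` to the origin if and only if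
`ξ + ∫ u(t) exp (-tA) B dt = 0`, so the `L¹`-optimal problem is convex with finitely many linear
constraints. Its Lagrange multipliers `c ≥ 0` and `q` yield a switching function
`h(t) = qᵀ exp (-tA) B` such that an `L¹`-optimal control minimizes `c |w| + w h(t)` over `[-1, 1]`
at almost every time: it vanishes where `|h| < c` and has modulus one where `|h| > c`. The set
`{|h| = c}` is null, by normality if `c > 0`, and by analyticity of the nonzero function `h` if
`c = 0`. So the closed support lies in `{|h| ≥ c}`, where the control has modulus one, and
`‖u‖₀ ≤ ‖u‖₁`. Since `‖v‖₁ ≤ ‖v‖₀` for every admissible `v`, the two problems have the same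
minimizers and the same value.
-/

namespace SparseControl

section LagrangeMultiplier

variable {E V : Type*} [AddCommGroup E] [Module ℝ E] [TopologicalSpace E] [IsTopologicalAddGroup E]
  [ContinuousSMul ℝ E] [AddCommGroup V] [Module ℝ V] {K : Set E} {φ : E → ℝ} {L : E →ₗ[ℝ] V} {u : E}

lemma exists_epigraph_separation (hK : IsOpen K) (hφ : ConvexOn ℝ K φ) (hφc : Continuous φ)
    (hmin : ∀ v ∈ K, L v = L u → φ u ≤ φ v) :
    ∃ f : StrongDual ℝ (E × ℝ), (∀ v ∈ K, ∀ r, φ v < r → f (u, φ u) < f (v, r)) ∧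
      ∀ w, L w = 0 → f (w, 0) = 0 := by
  have hopen : IsOpen {z : E × ℝ | z.1 ∈ K ∧ φ z.1 < z.2} :=
    (hK.preimage continuous_fst).inter (isOpen_lt (hφc.comp continuous_fst) continuous_snd)
  have hconvex : Convex ℝ {z : E × ℝ | L z.1 = L u ∧ z.2 = φ u} :=
    ((convex_singleton (L u)).is_linear_preimage (L.comp (LinearMap.fst ℝ E ℝ)).isLinear).inter
      ((convex_singleton (φ u)).is_linear_preimage (LinearMap.snd ℝ E ℝ).isLinear)
  have hdisj : Disjoint {z : E × ℝ | z.1 ∈ K ∧ φ z.1 < z.2} {z | L z.1 = L u ∧ z.2 = φ u} :=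
    Set.disjoint_left.2 fun z hz hzu ↦ (hz.2.trans_eq hzu.2).not_ge (hmin z.1 hz.1 hzu.1)
  obtain ⟨f, s, hlt, hle⟩ :=
    geometric_hahn_banach_open hφ.convex_strict_epigraph hopen hconvex hdisj
  refine ⟨-f, fun v hv r hr ↦ neg_lt_neg ((hlt (v, r) ⟨hv, hr⟩).trans_le (hle _ ⟨rfl, rfl⟩)),
    fun w hw ↦ ?_⟩
  have hbounded (k : ℝ) : s ≤ f (u, φ u) + k * f (w, 0) := by
    simpa [← smul_eq_mul, ← map_smul, ← map_add] using
      hle (u + k • w, φ u) ⟨by simp [hw], rfl⟩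
  by_contra hne
  have hfw : f (w, 0) ≠ 0 := fun h ↦ hne (by simp [h])
  have := hbounded ((s - 1 - f (u, φ u)) / f (w, 0))
  rw [div_mul_cancel₀ _ hfw] at this
  linarith

/-- When the multiplier `c` of the cost vanishes, the strict inequality on the open set `K`
excludes the trivial pair of multipliers. -/
theorem exists_lagrange_multiplier (hK : IsOpen K) (hKne : K.Nonempty) (hφ : ConvexOn ℝ K φ)
    (hφc : Continuous φ) (hmin : ∀ v ∈ K, L v = L u → φ u ≤ φ v) :
    ∃ (c : ℝ) (l : Module.Dual ℝ V), 0 ≤ c ∧ (c = 0 → ∀ v ∈ K, l (L u) < l (L v)) ∧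
      ∀ v ∈ closure K, c * φ u + l (L u) ≤ c * φ v + l (L v) := by
  obtain ⟨f, hsep, hker⟩ := exists_epigraph_separation hK hφ hφc hmin
  obtain ⟨l, hl⟩ : ∃ l : Module.Dual ℝ V, ∀ v, l (L v) = f (v, 0) := by
    have : (f : E × ℝ →ₗ[ℝ] ℝ) ∘ₗ LinearMap.inl ℝ E ℝ ∈ LinearMap.range L.dualMap := by
      rw [LinearMap.range_dualMap_eq_dualAnnihilator_ker, Submodule.mem_dualAnnihilator]
      exact hker
    obtain ⟨l, hl⟩ := this
    exact ⟨l, LinearMap.congr_fun hl⟩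
  set c := f (0, 1)
  have hf (v : E) (r : ℝ) : f (v, r) = c * r + l (L v) := by
    rw [hl, mul_comm, ← smul_eq_mul, ← map_smul, ← map_add]
    simp
  simp only [hf] at hsep
  have hc : 0 ≤ c := by
    obtain ⟨v, hv⟩ := hKne
    by_contra! hneg
    have hlarge := hsep v hv (max (φ v + 1) ((c * φ u + l (L u) - l (L v)) / c))
      (lt_max_of_lt_left (lt_add_one _))
    have := mul_le_mul_of_nonpos_left (le_max_right (φ v + 1)
      ((c * φ u + l (L u) - l (L v)) / c)) hneg.le
    rw [mul_div_cancel₀ _ hneg.ne] at this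
    linarith
  have hlc : Continuous fun v ↦ l (L v) := by
    simp only [hl]
    fun_prop
  refine ⟨c, l, hc, fun h0 v hv ↦ ?_, closure_minimal (fun v hv ↦ ?_)
    (isClosed_le continuous_const ((hφc.const_mul c).add hlc))⟩
  · simpa [h0] using hsep v hv (φ v + 1) (lt_add_one _)
  · refine ge_of_tendsto (x := 𝓝[>] φ v) (f := fun r ↦ c * r + l (L v)) ?_
      (eventually_mem_nhdsWithin.mono fun r hr ↦ (hsep v hv r hr).le)
    exact (Continuous.tendsto (by fun_prop) _).mono_left nhdsWithin_le_nhds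

end LagrangeMultiplier

/-- A minimizer of `w ↦ c |w| + y w` over `[-1, 1]`, for `c ≥ 0`. -/
noncomputable def bangOffBang (c y : ℝ) : ℝ := if |y| ≤ c then 0 else if 0 ≤ y then -1 else 1

lemma measurable_bangOffBang (c : ℝ) : Measurable (bangOffBang c) :=
  .ite (measurableSet_le (by fun_prop) measurable_const) measurable_const
    (.ite measurableSet_Ici measurable_const measurable_const)

lemma abs_bangOffBang_le_one (c y : ℝ) : |bangOffBang c y| ≤ 1 := by
  unfold bangOffBang
  split_ifs <;> simp

lemma mul_abs_bangOffBang_add {c : ℝ} (hc : 0 ≤ c) (y : ℝ) :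
    c * |bangOffBang c y| + bangOffBang c y * y = min 0 (c - |y|) := by
  unfold bangOffBang
  split_ifs <;> grind

lemma min_le_mul_abs_add {w : ℝ} (hw : |w| ≤ 1) (c y : ℝ) :
    min 0 (c - |y|) ≤ c * |w| + w * y :=
  calc min 0 (c - |y|) ≤ (c - |y|) * |w| := by
        rcases le_total 0 (c - |y|) with h | h
        · exact (min_le_left _ _).trans (mul_nonneg h (abs_nonneg w))
        · exact (min_le_right _ _).trans (le_mul_of_le_one_right h hw)
    _ = c * |w| + -|w * y| := by rw [abs_mul]; ring
    _ ≤ c * |w| + w * y := by gcongr; exact neg_abs_le _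

section EssentiallyBounded

variable {α F : Type*} [MeasurableSpace α] {μ : Measure α} [NormedAddCommGroup F]
  [NormedSpace ℝ F]

lemma ae_abs_le_of_norm_le {u : Lp ℝ ∞ μ} {C : ℝ} (hu : ‖u‖ ≤ C) : ∀ᵐ t ∂μ, |u t| ≤ C := by
  filter_upwards [ae_le_eLpNormEssSup (f := u) (μ := μ)] with t ht
  rw [← eLpNorm_exponent_top, ← Lp.enorm_def, enorm_le_iff_norm_le] at ht
  exact ht.trans hu

lemma integrable_smul_of_integrable {k : α → F} (hk : Integrable k μ) (u : Lp ℝ ∞ μ) :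
    Integrable (fun t ↦ u t • k t) μ :=
  hk.bdd_smul ‖u‖ (Lp.aestronglyMeasurable u) (ae_abs_le_of_norm_le le_rfl)

variable [CompleteSpace F]

/-- The moment map `u ↦ ∫ u k` of an integrable kernel `k`. -/
noncomputable def momentMap {k : α → F} (hk : Integrable k μ) : Lp ℝ ∞ μ →L[ℝ] F :=
  ((ContinuousLinearMap.lsmul ℝ ℝ).lpPairing μ ∞ 1).flip (hk.toL1 k)

lemma momentMap_apply {k : α → F} (hk : Integrable k μ) (u : Lp ℝ ∞ μ) :
    momentMap hk u = ∫ t, u t • k t ∂μ := by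
  rw [momentMap, ContinuousLinearMap.flip_apply, ContinuousLinearMap.lpPairing_eq_integral]
  refine integral_congr_ae ?_
  filter_upwards [hk.coeFn_toL1] with t ht
  simp only [ContinuousLinearMap.lsmul_apply, ht]

lemma map_momentMap {G : Type*} [NormedAddCommGroup G] [NormedSpace ℝ G] [CompleteSpace G]
    (f : F →L[ℝ] G) {k : α → F} (hk : Integrable k μ) (u : Lp ℝ ∞ μ) :
    f (momentMap hk u) = momentMap (f.integrable_comp hk) u := by
  rw [momentMap_apply, momentMap_apply,
    ← f.integral_comp_comm (integrable_smul_of_integrable hk u)]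
  simp only [map_smul]

variable [IsFiniteMeasure μ]

variable (μ) in
/-- The inclusion of `L^∞` into `L¹`. -/
noncomputable def inclusionL1 : Lp ℝ ∞ μ →L[ℝ] Lp ℝ 1 μ :=
  ((ContinuousLinearMap.lsmul ℝ ℝ).holderL μ ∞ 1 1).flip (Lp.const 1 μ 1)

lemma coeFn_inclusionL1 (u : Lp ℝ ∞ μ) : inclusionL1 μ u =ᵐ[μ] u := by
  filter_upwards [(ContinuousLinearMap.lsmul ℝ ℝ).coeFn_holder (r := 1) u (Lp.const 1 μ (1 : ℝ)),
    Lp.coeFn_const 1 μ (1 : ℝ)] with t ht hone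
  refine ht.trans ?_
  rw [hone]
  simp

lemma enorm_inclusionL1 (u : Lp ℝ ∞ μ) : ‖inclusionL1 μ u‖ₑ = eLpNorm u 1 μ := by
  rw [Lp.enorm_def, eLpNorm_congr_ae (coeFn_inclusionL1 u)]

lemma norm_inclusionL1 (u : Lp ℝ ∞ μ) : ‖inclusionL1 μ u‖ = ∫ t, |u t| ∂μ := by
  rw [L1.norm_eq_integral_norm]
  exact integral_congr_ae ((coeFn_inclusionL1 u).fun_comp _)

theorem ae_mul_abs_add_eq_min {h : α → ℝ} (hh : Integrable h μ) {c : ℝ} (hc : 0 ≤ c)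
    {u : Lp ℝ ∞ μ} (hu : ‖u‖ ≤ 1)
    (hmin : ∀ v : Lp ℝ ∞ μ, ‖v‖ ≤ 1 →
      c * ‖inclusionL1 μ u‖ + momentMap hh u ≤ c * ‖inclusionL1 μ v‖ + momentMap hh v) :
    ∀ᵐ t ∂μ, c * |u t| + u t * h t = min 0 (c - |h t|) := by
  have hmem : MemLp (fun t ↦ bangOffBang c (h t)) ∞ μ :=
    memLp_top_of_bound
      ((measurable_bangOffBang c).comp_aemeasurable hh.aemeasurable).aestronglyMeasurable 1
      (.of_forall fun t ↦ abs_bangOffBang_le_one c (h t))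
  have hv_eq := hmem.coeFn_toLp
  set v : Lp ℝ ∞ μ := hmem.toLp
  have hv : ‖v‖ ≤ 1 := by
    have : ∀ᵐ t ∂μ, ‖v t‖ ≤ 1 := by
      filter_upwards [hv_eq] with t ht
      exact ht ▸ abs_bangOffBang_le_one c (h t)
    simpa using Lp.norm_le_of_ae_bound zero_le_one this
  have hint (w : Lp ℝ ∞ μ) : Integrable (fun t ↦ c * |w t| + w t * h t) μ :=
    (((Lp.memLp w).integrable le_top).abs.const_mul c).add (integrable_smul_of_integrable hh w)
  have hintegral (w : Lp ℝ ∞ μ) :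
      ∫ t, (c * |w t| + w t * h t) ∂μ = c * ‖inclusionL1 μ w‖ + momentMap hh w := by
    rw [norm_inclusionL1, momentMap_apply, ← integral_const_mul]
    exact integral_add (((Lp.memLp w).integrable le_top).abs.const_mul c)
      (integrable_smul_of_integrable hh w)
  have hv_min : ∀ᵐ t ∂μ, c * |v t| + v t * h t = min 0 (c - |h t|) := by
    filter_upwards [hv_eq] with t ht
    rw [ht, mul_abs_bangOffBang_add hc]
  have hle : (fun t ↦ c * |v t| + v t * h t) ≤ᵐ[μ] fun t ↦ c * |u t| + u t * h t := by
    filter_upwards [hv_min, ae_abs_le_of_norm_le hu] with t hvt hut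
    exact hvt.trans_le (min_le_mul_abs_add hut c (h t))
  have heq := (integral_eq_iff_of_ae_le (hint v) (hint u) hle).1 <|
    (integral_mono_ae (hint v) (hint u) hle).antisymm (by simpa only [hintegral] using hmin v hv)
  filter_upwards [hv_min, heq] with t hvt ht
  exact ht.symm.trans hvt

end EssentiallyBounded

section IntegrationByParts

variable {ι κ : Type*} [Fintype ι] [Fintype κ] {a b : ℝ}

lemma eval_intervalIntegral {g : ℝ → ι → ℝ} (hg : IntervalIntegrable g volume a b) (i : ι) :
    (∫ t in a..b, g t) i = ∫ t in a..b, g t i :=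
  ((ContinuousLinearMap.proj (R := ℝ) (φ := fun _ : ι ↦ ℝ) i).intervalIntegral_comp_comm hg).symm

lemma intervalIntegrable_dotProduct {p g : ℝ → ι → ℝ} (hp : Continuous p)
    (hg : IntervalIntegrable g volume a b) :
    IntervalIntegrable (fun t ↦ p t ⬝ᵥ g t) volume a b := by
  simp only [dotProduct]
  rw [← Finset.sum_fn]
  exact .sum _ fun i _ ↦ IntervalIntegrable.continuousOn_mul ⟨hg.1.eval i, hg.2.eval i⟩
    ((continuous_apply i).comp hp).continuousOn

lemma intervalIntegrable_mulVec {M : ℝ → Matrix κ ι ℝ} {g : ℝ → ι → ℝ} (hM : Continuous M)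
    (hg : IntervalIntegrable g volume a b) :
    IntervalIntegrable (fun t ↦ M t *ᵥ g t) volume a b :=
  have h (i : κ) := intervalIntegrable_dotProduct (p := fun t ↦ M t i)
    ((continuous_apply i).comp hM) hg
  ⟨.of_eval fun i ↦ (h i).1, .of_eval fun i ↦ (h i).2⟩

lemma integral_deriv_mul_primitive {p p' g : ℝ → ℝ} (hp : ∀ t, HasDerivAt p (p' t) t)
    (hp' : Continuous p') (hg : IntervalIntegrable g volume a b) (c : ℝ) :
    ∫ t in a..b, (p' t * (c + ∫ s in a..t, g s) + p t * g t) =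
      p b * (c + ∫ s in a..b, g s) - p a * c := by
  obtain rfl : deriv p = p' := funext fun t ↦ (hp t).deriv
  have hp_ac : AbsolutelyContinuousOnInterval p a b :=
    (contDiff_one_iff_deriv.2
      ⟨fun t ↦ (hp t).differentiableAt, hp'⟩).contDiffOn.absolutelyContinuousOnInterval
  have hc_ac : AbsolutelyContinuousOnInterval (fun _ : ℝ ↦ c) a b :=
    (contDiff_const (n := 1)).contDiffOn.absolutelyContinuousOnInterval
  have h := hp_ac.integral_deriv_mul_eq_sub <|
    hc_ac.add (hg.absolutelyContinuousOnInterval_intervalIntegral left_mem_uIcc)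
  simp only [Pi.add_apply, intervalIntegral.integral_same, add_zero] at h
  rw [← h]
  refine intervalIntegral.integral_congr_ae ?_
  filter_upwards [hg.ae_hasDerivAt_integral] with t ht htab
  have := ((ht (uIoc_subset_uIcc htab) a left_mem_uIcc).const_add c).deriv
  rw [← this]
  rfl

lemma integral_dotProduct_primitive {p p' g : ℝ → ι → ℝ} (hp : ∀ t, HasDerivAt p (p' t) t)
    (hp' : Continuous p') (hg : IntervalIntegrable g volume a b) (ξ : ι → ℝ) :
    ∫ t in a..b, (p' t ⬝ᵥ (ξ + ∫ s in a..t, g s) + p t ⬝ᵥ g t) =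
      p b ⬝ᵥ (ξ + ∫ s in a..b, g s) - p a ⬝ᵥ ξ := by
  have hgi (i : ι) : IntervalIntegrable (g · i) volume a b := ⟨hg.1.eval i, hg.2.eval i⟩
  have hpi (i : ι) (t : ℝ) : HasDerivAt (p · i) (p' t i) t := hasDerivAt_pi.1 (hp t) i
  have hp'i (i : ι) : Continuous (p' · i) := (continuous_apply i).comp hp'
  have hint (i : ι) : IntervalIntegrable
      (fun t ↦ p' t i * (ξ i + ∫ s in a..t, g s i) + p t i * g t i) volume a b := by
    have hprim := intervalIntegral.continuousOn_primitive_interval' (hgi i) left_mem_uIcc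
    have hpc : Continuous (p · i) :=
      continuous_iff_continuousAt.2 fun t ↦ (hpi i t).continuousAt
    exact ((hp'i i).continuousOn.mul (continuousOn_const.add hprim)).intervalIntegrable.add
      ((hgi i).continuousOn_mul hpc.continuousOn)
  have heval {t : ℝ} (ht : t ∈ uIcc a b) (i : ι) :
      (ξ + ∫ s in a..t, g s) i = ξ i + ∫ s in a..t, g s i := by
    rw [Pi.add_apply, eval_intervalIntegral (hg.mono_set (uIcc_subset_uIcc_left ht))]
  calc ∫ t in a..b, (p' t ⬝ᵥ (ξ + ∫ s in a..t, g s) + p t ⬝ᵥ g t)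
      = ∫ t in a..b, ∑ i, (p' t i * (ξ i + ∫ s in a..t, g s i) + p t i * g t i) :=
        intervalIntegral.integral_congr fun t ht ↦ by
          simp only [dotProduct, heval ht, Finset.sum_add_distrib]
    _ = ∑ i, (p b i * (ξ i + ∫ s in a..b, g s i) - p a i * ξ i) := by
        rw [intervalIntegral.integral_finsetSum fun i _ ↦ hint i]
        exact Finset.sum_congr rfl fun i _ ↦
          integral_deriv_mul_primitive (hpi i) (hp'i i) (hgi i) (ξ i)
    _ = p b ⬝ᵥ (ξ + ∫ s in a..b, g s) - p a ⬝ᵥ ξ := by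
        simp only [dotProduct, heval right_mem_uIcc, Finset.sum_sub_distrib]

lemma integral_mulVec_primitive {M M' : ℝ → Matrix κ ι ℝ} {g : ℝ → ι → ℝ}
    (hM : ∀ t, HasDerivAt M (M' t) t) (hM' : Continuous M')
    (hg : IntervalIntegrable g volume a b) (ξ : ι → ℝ) :
    ∫ t in a..b, (M' t *ᵥ (ξ + ∫ s in a..t, g s) + M t *ᵥ g t) =
      M b *ᵥ (ξ + ∫ s in a..b, g s) - M a *ᵥ ξ := by
  have hrow (i : κ) (t : ℝ) : HasDerivAt (M · i) (M' t i) t := hasDerivAt_pi.1 (hM t) i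
  have hM_cont : Continuous M := continuous_pi fun i ↦
    continuous_iff_continuousAt.2 fun t ↦ (hrow i t).continuousAt
  have hprim : IntervalIntegrable (fun t ↦ ξ + ∫ s in a..t, g s) volume a b :=
    (continuousOn_const.add
      (intervalIntegral.continuousOn_primitive_interval' hg left_mem_uIcc)).intervalIntegrable
  ext i
  rw [eval_intervalIntegral
    ((intervalIntegrable_mulVec hM' hprim).add (intervalIntegrable_mulVec hM_cont hg))]
  exact integral_dotProduct_primitive (hrow i) ((continuous_apply i).comp hM') hg ξ

end IntegrationByParts

lemma ae_ne_zero_of_analyticAt {f : ℝ → ℝ} (hf : ∀ t, AnalyticAt ℝ f t) {t₀ : ℝ} (h : f t₀ ≠ 0) :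
    ∀ᵐ t, f t ≠ 0 := by
  have hcodiscrete : f ⁻¹' {0}ᶜ ∈ Filter.codiscrete ℝ :=
    AnalyticOnNhd.preimage_zero_mem_codiscrete (fun t _ ↦ hf t) h
  have hae := ae_restrict_le_codiscreteWithin (μ := volume) MeasurableSet.univ hcodiscrete
  rwa [Measure.restrict_univ] at hae

section Flow

variable {ι : Type*} [Fintype ι] [DecidableEq ι] (A : Matrix ι ι ℝ) (t : ℝ)

/-- The fundamental matrix `exp (tA)` of the linear system `dx/dt = A x`. -/
noncomputable def flow : Matrix ι ι ℝ := NormedSpace.exp (t • A)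

lemma flow_zero : flow A 0 = 1 := by
  simp [flow]

lemma flow_mul_flow_neg : flow A t * flow (-A) t = 1 := by
  rw [flow, flow, smul_neg, ← Matrix.exp_add_of_commute _ _ (Commute.refl (t • A)).neg_right,
    add_neg_cancel, NormedSpace.exp_zero]

open scoped Matrix.Norms.Operator in
lemma hasDerivAt_flow : HasDerivAt (flow A) (A * flow A t) t :=
  hasDerivAt_exp_smul_const' (𝕂 := ℝ) A t

open scoped Matrix.Norms.Operator in
lemma hasDerivAt_flow' : HasDerivAt (flow A) (flow A t * A) t :=
  hasDerivAt_exp_smul_const (𝕂 := ℝ) A t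

open scoped Matrix.Norms.Operator in
lemma continuous_flow : Continuous (flow A) :=
  continuous_iff_continuousAt.2 fun t ↦ (hasDerivAt_flow A t).continuousAt

open scoped Matrix.Norms.Operator in
lemma analyticAt_flow_apply (i j : ι) : AnalyticAt ℝ (fun t ↦ flow A t i j) t :=
  have hflow : AnalyticAt ℝ (flow A) t := (NormedSpace.exp_analytic (𝕂 := ℝ) (t • A)).comp_of_eq
    (f := fun s : ℝ ↦ s • A) (analyticAt_id.smul analyticAt_const) rfl
  ((Matrix.entryLinearMap ℝ ℝ i j).toContinuousLinearMap.analyticAt _).comp hflow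

variable (B q : ι → ℝ)

/-- The kernel `exp (-tA) B` through which a control acts on the initial state, see
`mem_admissible_iff`. -/
noncomputable def impulseResponse : ι → ℝ := flow (-A) t *ᵥ B

/-- The solution of the adjoint equation `dp/dt = -Aᵀ p` with `p(0) = q`. -/
noncomputable def costate : ι → ℝ := q ᵥ* flow (-A) t

lemma dotProduct_costate : B ⬝ᵥ costate A t q = q ⬝ᵥ impulseResponse A t B := by
  rw [costate, impulseResponse, Matrix.dotProduct_mulVec, dotProduct_comm]

lemma hasDerivAt_costate : HasDerivAt (costate A · q) (-(Aᵀ *ᵥ costate A t q)) t := by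
  have hentry (i j : ι) : HasDerivAt (fun t ↦ flow (-A) t i j) ((flow (-A) t * -A) i j) t :=
    hasDerivAt_pi.1 (hasDerivAt_pi.1 (hasDerivAt_flow' (-A) t) i) j
  rw [Matrix.mulVec_transpose, ← Matrix.vecMul_neg, costate, Matrix.vecMul_vecMul]
  exact hasDerivAt_pi.2 fun j ↦ HasDerivAt.fun_sum fun i _ ↦ (hentry i j).const_mul (q i)

lemma continuous_impulseResponse : Continuous (impulseResponse A · B) :=
  (continuous_flow (-A)).matrix_mulVec continuous_const

lemma analyticAt_dotProduct_impulseResponse :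
    AnalyticAt ℝ (fun t ↦ q ⬝ᵥ impulseResponse A t B) t :=
  Finset.analyticAt_fun_sum _ fun i _ ↦ analyticAt_const.mul <|
    Finset.analyticAt_fun_sum _ fun j _ ↦ (analyticAt_flow_apply (-A) t i j).mul analyticAt_const

end Flow

section Admissible

variable {n : ℕ} {T : ℝ} {A : Matrix (Fin n) (Fin n) ℝ} {B ξ : Fin n → ℝ} {u : Signal T}

lemma intervalIntegrable_signal_smul {k : ℝ → Fin n → ℝ} (hk : Continuous k) (u : Signal T) {t : ℝ}
    (ht : t ∈ Icc 0 T) : IntervalIntegrable (fun s ↦ u s • k s) volume 0 t := by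
  have : IntegrableOn (fun s ↦ u s • k s) (Icc 0 T) :=
    integrable_smul_of_integrable (μ := horizon T) hk.integrableOn_Icc u
  rw [intervalIntegrable_iff_integrableOn_Icc_of_le ht.1]
  exact this.mono_set (Icc_subset_Icc_right ht.2)

lemma IsTrajectory.flow_neg_mulVec {x : ℝ → Fin n → ℝ} (hx : IsTrajectory A B ξ u x) {t : ℝ}
    (ht : t ∈ Icc 0 T) :
    flow (-A) t *ᵥ x t = ξ + ∫ s in (0 : ℝ)..t, u s • impulseResponse A s B := by
  have hint : IntervalIntegrable (fun s ↦ A *ᵥ x s + u s • B) volume 0 t := by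
    refine (intervalIntegrable_mulVec continuous_const (ContinuousOn.intervalIntegrable ?_)).add
      (intervalIntegrable_signal_smul continuous_const u ht)
    rw [uIcc_of_le ht.1]
    exact hx.continuousOn.mono (Icc_subset_Icc_right ht.2)
  have hparts := integral_mulVec_primitive (hasDerivAt_flow' (-A))
    ((continuous_flow (-A)).matrix_mul continuous_const) hint ξ
  rw [← hx.eq_integral t ht, flow_zero, Matrix.one_mulVec, eq_sub_iff_add_eq'] at hparts
  rw [← hparts]
  congr 1
  refine intervalIntegral.integral_congr fun s hs ↦ ?_
  rw [uIcc_of_le ht.1] at hs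
  simp only [← hx.eq_integral s ⟨hs.1, hs.2.trans ht.2⟩, Matrix.mulVec_add, Matrix.mulVec_smul,
    ← Matrix.mulVec_mulVec, Matrix.neg_mulVec, Matrix.mulVec_neg, impulseResponse]
  abel

lemma isTrajectory_flow_mulVec (A : Matrix (Fin n) (Fin n) ℝ) (B ξ : Fin n → ℝ) (u : Signal T) :
    IsTrajectory A B ξ u fun t ↦
      flow A t *ᵥ (ξ + ∫ s in (0 : ℝ)..t, u s • impulseResponse A s B) where
  continuousOn t ht := by
    have hprim := intervalIntegral.continuousOn_primitive_interval' (intervalIntegrable_signal_smul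
      (continuous_impulseResponse A B) u (right_mem_Icc.2 (ht.1.trans ht.2))) left_mem_uIcc
    rw [uIcc_of_le (ht.1.trans ht.2)] at hprim
    exact (continuous_fst.matrix_mulVec continuous_snd).comp_continuousOn
      ((continuous_flow A).continuousOn.prodMk (continuousOn_const.add hprim)) t ht
  eq_integral t ht := by
    have hparts := integral_mulVec_primitive (hasDerivAt_flow A)
      (continuous_const.matrix_mul (continuous_flow A))
      (intervalIntegrable_signal_smul (continuous_impulseResponse A B) u ht) ξ
    rw [flow_zero, Matrix.one_mulVec, eq_sub_iff_add_eq'] at hparts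
    rw [← hparts]
    simp only [impulseResponse, Matrix.mulVec_smul, Matrix.mulVec_mulVec, flow_mul_flow_neg,
      Matrix.one_mulVec]

lemma integrable_impulseResponse (A : Matrix (Fin n) (Fin n) ℝ) (B : Fin n → ℝ) (T : ℝ) :
    Integrable (impulseResponse A · B) (horizon T) :=
  (continuous_impulseResponse A B).integrableOn_Icc

/-- The steering map `u ↦ ∫ u(t) exp (-tA) B dt` over `[0, T]`. -/
noncomputable def steeringMap (A : Matrix (Fin n) (Fin n) ℝ) (B : Fin n → ℝ) (T : ℝ) :
    Signal T →L[ℝ] Fin n → ℝ :=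
  momentMap (integrable_impulseResponse A B T)

lemma steeringMap_eq_intervalIntegral (hT : 0 ≤ T) (u : Signal T) :
    steeringMap A B T u = ∫ t in (0 : ℝ)..T, u t • impulseResponse A t B := by
  rw [steeringMap, momentMap_apply, integral_Icc_eq_integral_Ioc,
    intervalIntegral.integral_of_le hT]

theorem mem_admissible_iff (hT : 0 ≤ T) :
    u ∈ admissible A B T ξ ↔ ‖u‖ ≤ 1 ∧ ξ + steeringMap A B T u = 0 := by
  rw [steeringMap_eq_intervalIntegral hT]
  refine and_congr_right fun _ ↦ ⟨?_, fun h ↦ ⟨_, isTrajectory_flow_mulVec A B ξ u, ?_⟩⟩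
  · rintro ⟨x, hx, hxT⟩
    rw [← hx.flow_neg_mulVec (right_mem_Icc.2 hT), hxT, Matrix.mulVec_zero]
  · rw [h, Matrix.mulVec_zero]

end Admissible

section Support

variable {T : ℝ} {u : Signal T}

lemma measurableSet_signal_ne_zero (u : Signal T) : MeasurableSet {t | u t ≠ 0} :=
  (Lp.stronglyMeasurable u).measurable (measurableSet_singleton 0).compl

lemma signalSupport_eq_support (u : Signal T) :
    signalSupport u = ((horizon T).restrict {t | u t ≠ 0}).support := by
  have happly (N : Set ℝ) : (horizon T).restrict {t | u t ≠ 0} N =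
      volume {t | t ∈ N ∧ t ∈ Icc 0 T ∧ u t ≠ 0} := by
    rw [Measure.restrict_apply' (measurableSet_signal_ne_zero u),
      Measure.restrict_apply' measurableSet_Icc, inter_assoc, inter_comm {t | u t ≠ 0}]
    rfl
  have hIcc : ((horizon T).restrict {t | u t ≠ 0}).support ⊆ Icc 0 T :=
    Measure.support_subset_of_isClosed isClosed_Icc
      (ae_restrict_of_ae (ae_restrict_mem measurableSet_Icc))
  ext t
  refine ⟨fun ht ↦ ?_, fun ht ↦ ⟨hIcc ht, ?_⟩⟩
  · simpa only [Measure.mem_support_iff_forall, happly] using ht.2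
  · simpa only [Measure.mem_support_iff_forall, happly] using ht

lemma l1Norm_le_l0Norm (hu : ‖u‖ ≤ 1) : l1Norm u ≤ l0Norm u := by
  have hbound : ∀ᵐ t ∂(horizon T).restrict {t | u t ≠ 0}, ‖u t‖ ≤ 1 :=
    ae_restrict_of_ae (ae_abs_le_of_norm_le hu)
  calc l1Norm u = eLpNorm u 1 ((horizon T).restrict {t | u t ≠ 0}) :=
        (eLpNorm_restrict_eq_of_support_subset Subset.rfl).symm
    _ ≤ (horizon T).restrict {t | u t ≠ 0} univ := by
        simpa using eLpNorm_le_of_ae_bound (p := 1) hbound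
    _ = (horizon T).restrict {t | u t ≠ 0} (signalSupport u) := by
        rw [signalSupport_eq_support]
        exact (measure_congr (Filter.eventuallyEq_univ.2 Measure.support_mem_ae)).symm
    _ ≤ l0Norm u := (Measure.restrict_apply_le _ _).trans (Measure.restrict_apply_le _ _)

/-- A control that minimizes `c |w| + w h(t)` over `[-1, 1]` at almost every time takes only the
values `-1`, `0` and `1`, up to the exceptional set `{|h| = c}`. -/
lemma l0Norm_le_l1Norm {h : ℝ → ℝ} (hh : Continuous h) {c : ℝ}
    (hmin : ∀ᵐ t ∂horizon T, c * |u t| + u t * h t = min 0 (c - |h t|))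
    (hne : ∀ᵐ t ∂horizon T, |h t| ≠ c) : l0Norm u ≤ l1Norm u := by
  have hmul : ∀ᵐ t ∂horizon T, (c - |h t|) * |u t| ≤ min 0 (c - |h t|) := by
    filter_upwards [hmin] with t ht
    rw [← ht, sub_mul, mul_comm |h t|, ← abs_mul]
    linarith [neg_abs_le (u t * h t)]
  have hF : IsClosed {t | c ≤ |h t|} := isClosed_le continuous_const hh.abs
  have hsub : signalSupport u ⊆ {t | c ≤ |h t|} := by
    rw [signalSupport_eq_support]
    refine Measure.support_subset_of_isClosed hF
      ((ae_restrict_iff' (measurableSet_signal_ne_zero u)).2 ?_)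
    filter_upwards [hmul] with t ht hut
    by_contra! hlt
    exact (mul_pos (sub_pos.2 hlt) (abs_pos.2 hut)).not_ge (ht.trans (min_le_left _ _))
  have hone : ∀ᵐ t ∂horizon T, c ≤ |h t| → 1 ≤ ‖u t‖ₑ := by
    filter_upwards [hmul, hne] with t ht hht hle
    have hneg : c - |h t| < 0 := sub_neg.2 (hle.lt_of_ne' hht)
    rw [← enorm_one (G := ℝ), enorm_le_iff_norm_le, norm_one]
    exact (mul_le_mul_left_of_neg hneg).1 (by simpa using ht.trans (min_le_right _ _))
  calc l0Norm u ≤ volume ({t | c ≤ |h t|} ∩ Icc 0 T) :=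
        measure_mono (subset_inter hsub fun t ht ↦ ht.1)
    _ = horizon T {t | c ≤ |h t|} := (Measure.restrict_apply hF.measurableSet).symm
    _ ≤ horizon T {t | 1 ≤ ‖u t‖ₑ} := measure_mono_ae hone
    _ ≤ ∫⁻ t, ‖u t‖ₑ ∂horizon T := by
        simpa using mul_meas_ge_le_lintegral₀ (Lp.aestronglyMeasurable u).enorm 1
    _ = l1Norm u := eLpNorm_one_eq_lintegral_enorm.symm

end Support

section Optimality

variable {n : ℕ} {T : ℝ} {A : Matrix (Fin n) (Fin n) ℝ} {B ξ : Fin n → ℝ} {u : Signal T}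

lemma norm_inclusionL1_le_of_mem_l1Optimal (hu : u ∈ l1Optimal A B T ξ) {v : Signal T}
    (hv : v ∈ admissible A B T ξ) :
    ‖inclusionL1 (horizon T) u‖ ≤ ‖inclusionL1 (horizon T) v‖ := by
  rw [← enorm_le_iff_norm_le, enorm_inclusionL1, enorm_inclusionL1]
  exact hu.2 v hv

/-- `c` is the multiplier of the cost and `q` that of the terminal constraint. -/
lemma exists_multiplier_of_mem_l1Optimal (hT : 0 ≤ T) (hu : u ∈ l1Optimal A B T ξ) :
    ∃ (c : ℝ) (q : Fin n → ℝ), 0 ≤ c ∧ (c = 0 → ∃ t, q ⬝ᵥ impulseResponse A t B ≠ 0) ∧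
      ∀ᵐ t ∂horizon T, c * |u t| + u t * (q ⬝ᵥ impulseResponse A t B) =
        min 0 (c - |q ⬝ᵥ impulseResponse A t B|) := by
  obtain ⟨hu_norm, hu_zero⟩ := (mem_admissible_iff hT).1 hu.1
  have hconvex : ConvexOn ℝ (Metric.ball 0 1) fun v : Signal T ↦ ‖inclusionL1 (horizon T) v‖ :=
    (convexOn_univ_norm.comp_linearMap (inclusionL1 (horizon T)).toLinearMap).subset
      (subset_univ _) (convex_ball 0 1)
  obtain ⟨c, l, hc, hc0, hmin⟩ := exists_lagrange_multiplier (L := (steeringMap A B T).toLinearMap)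
    (u := u) Metric.isOpen_ball ⟨0, Metric.mem_ball_self one_pos⟩ hconvex (by fun_prop)
    fun v hv hLv ↦ norm_inclusionL1_le_of_mem_l1Optimal hu <| (mem_admissible_iff hT).2
      ⟨(mem_ball_zero_iff.1 hv).le, (congrArg (ξ + ·) hLv).trans hu_zero⟩
  obtain ⟨q, rfl⟩ := (dotProductEquiv ℝ (Fin n)).surjective l
  have hk : Integrable (fun t ↦ q ⬝ᵥ impulseResponse A t B) (horizon T) :=
    (dotProductEquiv ℝ (Fin n) q).toContinuousLinearMap.integrable_comp
      (integrable_impulseResponse A B T)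
  have hl (v : Signal T) : dotProductEquiv ℝ (Fin n) q (steeringMap A B T v) = momentMap hk v :=
    map_momentMap (dotProductEquiv ℝ (Fin n) q).toContinuousLinearMap
      (integrable_impulseResponse A B T) v
  simp only [ContinuousLinearMap.coe_coe, hl] at hc0 hmin
  refine ⟨c, q, hc, fun h0 ↦ ?_, ae_mul_abs_add_eq_min hk hc hu_norm fun v hv ↦ hmin v ?_⟩
  · by_contra! hzero
    have := hc0 h0 0 (Metric.mem_ball_self one_pos)
    simp [momentMap_apply, hzero] at this
  · rwa [closure_ball _ one_ne_zero, mem_closedBall_zero_iff]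

lemma minimumPrinciple_costate {x : ℝ → Fin n → ℝ} (hx : IsTrajectory A B ξ u x) (hxT : x T = 0)
    {c : ℝ} (hc : 0 < c) {q : Fin n → ℝ}
    (hmin : ∀ᵐ t ∂horizon T, c * |u t| + u t * (q ⬝ᵥ impulseResponse A t B) =
      min 0 (c - |q ⬝ᵥ impulseResponse A t B|)) :
    MinimumPrinciple A B ξ u x (costate A · (c⁻¹ • q)) where
  trajectory := hx
  final := hxT
  adjoint t _ := (hasDerivAt_costate A t _).hasDerivWithinAt
  minimum := by
    filter_upwards [hmin] with t ht w hw
    have hH (w : ℝ) : hamiltonian A B (x t) (costate A t (c⁻¹ • q)) w =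
        c⁻¹ * (c * |w| + w * (q ⬝ᵥ impulseResponse A t B)) +
          costate A t (c⁻¹ • q) ⬝ᵥ A *ᵥ x t := by
      rw [hamiltonian, dotProduct_add, dotProduct_smul, dotProduct_comm _ B, dotProduct_costate,
        smul_dotProduct, smul_eq_mul, smul_eq_mul]
      field_simp
      ring
    rw [hH, hH, ht]
    gcongr
    exact min_le_mul_abs_add hw c _

lemma ae_abs_ne_of_isNormal (hnormal : IsNormal A B T ξ) (hu : u ∈ l1Optimal A B T ξ) {c : ℝ}
    (hc : 0 < c) {q : Fin n → ℝ}
    (hmin : ∀ᵐ t ∂horizon T, c * |u t| + u t * (q ⬝ᵥ impulseResponse A t B) =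
      min 0 (c - |q ⬝ᵥ impulseResponse A t B|)) :
    ∀ᵐ t ∂horizon T, |q ⬝ᵥ impulseResponse A t B| ≠ c := by
  obtain ⟨-, x, hx, hxT⟩ := hu.1
  have hnull := hnormal u hu x _ (minimumPrinciple_costate hx hxT hc hmin)
  rw [ae_restrict_iff' measurableSet_Icc, ae_iff]
  refine measure_mono_null (fun t ht ↦ ?_) hnull
  obtain ⟨htT, heq⟩ := Classical.not_imp.1 ht
  refine ⟨htT, ?_⟩
  rw [dotProduct_costate, smul_dotProduct, smul_eq_mul, abs_mul, abs_of_pos (inv_pos.2 hc),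
    not_not.1 heq, inv_mul_cancel₀ hc.ne']

lemma l0Norm_le_l1Norm_of_mem_l1Optimal (hT : 0 ≤ T) (hnormal : IsNormal A B T ξ)
    (hu : u ∈ l1Optimal A B T ξ) : l0Norm u ≤ l1Norm u := by
  obtain ⟨c, q, hc, hc0, hmin⟩ := exists_multiplier_of_mem_l1Optimal hT hu
  refine l0Norm_le_l1Norm (continuous_const.dotProduct (continuous_impulseResponse A B)) hmin ?_
  rcases hc.eq_or_lt with rfl | hc_pos
  · obtain ⟨t₀, ht₀⟩ := hc0 rfl
    refine ae_restrict_of_ae ?_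
    filter_upwards [ae_ne_zero_of_analyticAt
      (fun t ↦ analyticAt_dotProduct_impulseResponse A t B q) ht₀] with t ht
    exact abs_ne_zero.2 ht
  · exact ae_abs_ne_of_isNormal hnormal hu hc_pos hmin

end Optimality

end SparseControl

theorem theorem4p1 {n : ℕ} (A : Matrix (Fin n) (Fin n) ℝ) (B : Fin n → ℝ) (T : ℝ) (hT : 0 < T)
    (ξ : Fin n → ℝ) (hnormal : SparseControl.IsNormal A B T ξ)
    (hexists : (SparseControl.l1Optimal A B T ξ).Nonempty) :
    SparseControl.sparseOptimal A B T ξ = SparseControl.l1Optimal A B T ξ ∧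
      ∀ u₀ ∈ SparseControl.sparseOptimal A B T ξ, ∀ u₁ ∈ SparseControl.l1Optimal A B T ξ,
        SparseControl.l0Norm u₀ = SparseControl.l1Norm u₁ := by
  have hle {u : SparseControl.Signal T} (hu : u ∈ SparseControl.l1Optimal A B T ξ) :
      SparseControl.l0Norm u ≤ SparseControl.l1Norm u :=
    SparseControl.l0Norm_le_l1Norm_of_mem_l1Optimal hT.le hnormal hu
  have hge {u : SparseControl.Signal T} (hu : u ∈ SparseControl.admissible A B T ξ) :
      SparseControl.l1Norm u ≤ SparseControl.l0Norm u :=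
    SparseControl.l1Norm_le_l0Norm hu.1
  refine ⟨Set.Subset.antisymm (fun u hu ↦ ⟨hu.1, fun v hv ↦ ?_⟩)
    fun u hu ↦ ⟨hu.1, fun v hv ↦ (hle hu).trans ((hu.2 v hv).trans (hge hv))⟩,
    fun u₀ hu₀ u₁ hu₁ ↦ le_antisymm ((hu₀.2 u₁ hu₁.1).trans (hle hu₁))
      ((hu₁.2 u₀ hu₀.1).trans (hge hu₀.1))⟩
  obtain ⟨u₁, hu₁⟩ := hexists
  exact (hge hu.1).trans ((hu.2 u₁ hu₁.1).trans ((hle hu₁).trans (hu₁.2 v hv)))
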